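/- Let $G$ be a finite group of order $n$. For $g \in G$ let $o(g)$ denote the order of $g$, and let $\phi$ denote Euler's totient function. Then $$\sum_{d \mid n} (2d - \phi(d))\,\phi(d) \;\ge\; \sum_{g \in G} \bigl(2\,o(g) - \phi(o(g))\bigr),$$ where the left-hand sum runs over the positive divisors $d$ of $n$. Equality holds if and only if $G$ is cyclic. -/

import Mathlib

/-! All weights `a d - b φ(d)` with `0 < b` and `2 b ≤ a` are treated at once: fixing a coprime
factor `d` turns `(a, b)` into `(a d, b φ(d))`, which stays in this range. Strong induction on the
group order shows that `G` is cyclic as soon as its sum reaches that of the cyclic group of order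
`n`; both claims follow.

Let `p` be the largest prime divisor of `n`. An Euler-product bound for the cyclic sum forces an
element `x` with `n < p * orderOf x` (`exists_lt_mul_orderOf`). As `⟨x⟩` has index below `p`, the
Sylow `p`-subgroup `P` is cyclic and normal, with a complement `K`. An element `y` of `K` either
centralizes `P` or satisfies `(x y) ^ orderOf y = 1` for all `x ∈ P`
(`mul_pow_orderOf_eq_one_or_commute`). So `orderOf (x y)` divides `orderOf x * orderOf y`, and the
sum over `G` is bounded by weighted sums over `K`. Induction makes `K` cyclic, strictness makes it
centralize `P`, and `G` is cyclic. -/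

/-- The sum of `F d` weighted by `φ d` over the divisors `d` of `n`; it is the sum of `F (orderOf g)`
over a cyclic group of order `n`. -/
def totientDivisorSum (n : ℕ) (F : ℕ → ℤ) : ℤ := ∑ d ∈ n.divisors, (Nat.totient d : ℤ) * F d

/-- The linear combination `a d - b φ(d)`. -/
def totientWeight (a b : ℤ) (d : ℕ) : ℤ := a * d - b * Nat.totient d

/-! ### Divisor sums and their Euler products -/

theorem totientDivisorSum_mul {m n : ℕ} (h : m.Coprime n) (F : ℕ → ℤ) :
    totientDivisorSum (m * n) F
      = totientDivisorSum m fun d => totientDivisorSum n fun e => F (d * e) := by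
  unfold totientDivisorSum
  rw [Nat.divisors_mul, Finset.mul_def, Finset.sum_image h.mul_injOn_divisors,
    Finset.sum_product]
  refine Finset.sum_congr rfl fun d hd => ?_
  rw [Finset.mul_sum]
  refine Finset.sum_congr rfl fun e he => ?_
  have hde : d.Coprime e :=
    (h.coprime_dvd_left (Nat.dvd_of_mem_divisors hd)).coprime_dvd_right (Nat.dvd_of_mem_divisors he)
  rw [Nat.totient_mul hde]
  push_cast
  ring

theorem totientDivisorSum_mono {n : ℕ} {F F' : ℕ → ℤ} (h : ∀ d, d ∣ n → F d ≤ F' d) :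
    totientDivisorSum n F ≤ totientDivisorSum n F' :=
  Finset.sum_le_sum fun d hd =>
    mul_le_mul_of_nonneg_left (h d (Nat.dvd_of_mem_divisors hd)) (by positivity)

theorem totientDivisorSum_mul_left (n : ℕ) (c : ℤ) (F : ℕ → ℤ) :
    totientDivisorSum n (fun d => c * F d) = c * totientDivisorSum n F := by
  unfold totientDivisorSum
  rw [Finset.mul_sum]
  exact Finset.sum_congr rfl fun d _ => by ring

theorem totientDivisorSum_mul_right (n : ℕ) (c : ℤ) (F : ℕ → ℤ) :
    totientDivisorSum n (fun d => F d * c) = totientDivisorSum n F * c := by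
  simp only [mul_comm _ c, totientDivisorSum_mul_left]

theorem totientDivisorSum_one (F : ℕ → ℤ) : totientDivisorSum 1 F = F 1 := by
  simp [totientDivisorSum]

theorem totientDivisorSum_prime_pow_succ {p : ℕ} (hp : p.Prime) (k : ℕ) (F : ℕ → ℤ) :
    totientDivisorSum (p ^ (k + 1)) F
      = totientDivisorSum (p ^ k) F + p ^ k * ((p : ℤ) - 1) * F (p ^ (k + 1)) := by
  unfold totientDivisorSum
  rw [Nat.sum_divisors_prime_pow hp, Nat.sum_divisors_prime_pow hp, Finset.sum_range_succ,
    Nat.totient_prime_pow_succ hp, Nat.cast_mul, Nat.cast_sub hp.one_le]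
  push_cast
  ring

theorem totientDivisorSum_cast_nonneg (n : ℕ) : 0 ≤ totientDivisorSum n (fun d => (d : ℤ)) :=
  Finset.sum_nonneg fun _ _ => by positivity

theorem succ_mul_totientDivisorSum_prime_pow {p : ℕ} (hp : p.Prime) (k : ℕ) :
    ((p : ℤ) + 1) * totientDivisorSum (p ^ k) (fun d => (d : ℤ)) = p * (p ^ k) ^ 2 + 1 := by
  induction k with
  | zero => simp [totientDivisorSum_one]
  | succ k ih =>
    rw [totientDivisorSum_prime_pow_succ hp, mul_add, ih]
    push_cast
    ring

/-- The local factor at an odd prime `q` is at least `q / (q + 1)` times `q ^ (2k)`. Replacing the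
primes by all integers from `3` to `N`, the product of `q / (q + 1)` telescopes to `3 / (N + 1)`. -/
theorem three_mul_sq_le_of_odd {N m : ℕ} (hN : 2 ≤ N) (hm : Odd m)
    (hpm : ∀ p, p.Prime → p ∣ m → p ≤ N) :
    3 * (m : ℤ) ^ 2 ≤ ((N : ℤ) + 1) * totientDivisorSum m (fun d => (d : ℤ)) := by
  induction N, hN using Nat.le_induction generalizing m with
  | base =>
    have : m = 1 := by
      by_contra h
      obtain ⟨p, hp, hpm'⟩ := Nat.exists_prime_and_dvd h
      have h2 : p = 2 := le_antisymm (hpm p hp hpm') hp.two_le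
      subst h2
      exact (Nat.not_even_iff_odd.2 hm) (even_iff_two_dvd.2 hpm')
    subst this
    simp [totientDivisorSum_one]
  | succ N hN ih =>
    by_cases hq : (N + 1).Prime
    · have hm0 : m ≠ 0 := by rintro rfl; simp at hm
      obtain ⟨k, m', hm', rfl⟩ := Nat.exists_eq_pow_mul_and_not_dvd hm0 (N + 1) hq.ne_one
      have hcop : ((N + 1) ^ k).Coprime m' :=
        Nat.Coprime.pow_left _ ((Nat.Prime.coprime_iff_not_dvd hq).2 hm')
      have h1 := ih (Nat.odd_mul.1 hm).2 fun p hp hpm' => by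
        have h2 := hpm p hp (hpm'.mul_left _)
        rcases h2.lt_or_eq with h3 | h3
        · omega
        · exact absurd (h3 ▸ hpm') hm'
      have h2 := succ_mul_totientDivisorSum_prime_pow hq k
      have h3 := totientDivisorSum_cast_nonneg m'
      rw [totientDivisorSum_mul hcop]
      push_cast at h2 ⊢
      simp only [totientDivisorSum_mul_left, totientDivisorSum_mul_right]
      rw [← mul_assoc, h2]
      have h4 := mul_le_mul_of_nonneg_left h1 (sq_nonneg (((N : ℤ) + 1) ^ k))
      linarith
    · have h1 := ih hm fun p hp hpm' => by
        have h2 := hpm p hp hpm'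
        have : p ≠ N + 1 := fun h => hq (h ▸ hp)
        omega
      have h3 := totientDivisorSum_cast_nonneg m
      push_cast
      linarith

/-! ### The weights, and a lower bound for the cyclic sum -/

theorem totientWeight_mul (a b : ℤ) {d e : ℕ} (h : d.Coprime e) :
    totientWeight a b (d * e) = totientWeight (a * d) (b * Nat.totient d) e := by
  unfold totientWeight
  rw [Nat.totient_mul h]
  push_cast
  ring

theorem totientWeight_lt_mul {a b : ℤ} (hb : 0 < b) {d : ℕ} (hd : 0 < d) :
    totientWeight a b d < a * d := by
  have : (0 : ℤ) < Nat.totient d := by exact_mod_cast Nat.totient_pos.2 hd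
  unfold totientWeight
  nlinarith

theorem mul_le_two_mul_totientWeight {a b : ℤ} (hb : 0 ≤ b) (hab : 2 * b ≤ a) (d : ℕ) :
    a * d ≤ 2 * totientWeight a b d := by
  have h1 : (Nat.totient d : ℤ) ≤ d := by exact_mod_cast Nat.totient_le d
  unfold totientWeight
  nlinarith

theorem totientWeight_lt_of_dvd {a b : ℤ} (hb : 0 < b) (hab : 2 * b ≤ a) {d e : ℕ} (h : d ∣ e)
    (hd : 0 < d) (hde : d < e) : totientWeight a b d < totientWeight a b e := by
  obtain ⟨k, rfl⟩ := h
  have h1 := totientWeight_lt_mul (a := a) hb hd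
  have h2 := mul_le_two_mul_totientWeight hb.le hab (d * k)
  have hk : 2 ≤ k := by
    by_contra! hk
    have := Nat.mul_le_mul_left d (Nat.le_of_lt_succ hk)
    omega
  have h3 : (2 : ℤ) * d ≤ (d * k : ℕ) := by
    rw [mul_comm d k]; exact_mod_cast Nat.mul_le_mul_right d hk
  nlinarith

theorem totientWeight_le_of_dvd {a b : ℤ} (hb : 0 < b) (hab : 2 * b ≤ a) {d e : ℕ} (h : d ∣ e)
    (he : 0 < e) : totientWeight a b d ≤ totientWeight a b e := by
  rcases (Nat.le_of_dvd he h).lt_or_eq with h1 | rfl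
  · exact (totientWeight_lt_of_dvd hb hab h (Nat.pos_of_dvd_of_pos h he) h1).le
  · exact le_rfl

/-- The exact value of `φ(2 ^ j)` is used here: the crude `a d ≤ 2 W(d)` would lose more than the
factor `1/2`. -/
theorem mul_sq_le_totientDivisorSum_two_pow {a b : ℤ} (hab : 2 * b ≤ a) (k : ℕ) :
    a * ((2 : ℤ) ^ k) ^ 2 ≤ 2 * totientDivisorSum (2 ^ k) (totientWeight a b) := by
  induction k with
  | zero =>
    simp [totientDivisorSum_one, totientWeight]
    linarith
  | succ k ih =>
    rw [totientDivisorSum_prime_pow_succ Nat.prime_two]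
    unfold totientWeight at ih ⊢
    rw [Nat.totient_prime_pow_succ Nat.prime_two]
    push_cast
    have : 0 ≤ ((2 : ℤ) ^ k) ^ 2 := by positivity
    have h3 := mul_le_mul_of_nonneg_right hab this
    ring_nf at ih h3 ⊢
    linarith

theorem mul_sq_le_totientDivisorSum_totientWeight {a b : ℤ} (hb : 0 < b) (hab : 2 * b ≤ a)
    {n p : ℕ} (hn : n ≠ 0) (hp : 2 ≤ p) (hpn : ∀ q, q.Prime → q ∣ n → q ≤ p) :
    3 * a * (n : ℤ) ^ 2 ≤ 2 * ((p : ℤ) + 1) * totientDivisorSum n (totientWeight a b) := by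
  obtain ⟨k, m, hm, rfl⟩ := Nat.exists_eq_pow_mul_and_not_dvd hn 2 (by norm_num)
  have hcop : (2 ^ k).Coprime m :=
    Nat.Coprime.pow_left _ ((Nat.Prime.coprime_iff_not_dvd Nat.prime_two).2 hm)
  have hodd : Odd m := Nat.not_even_iff_odd.1 fun h => hm (even_iff_two_dvd.1 h)
  have h1 := three_mul_sq_le_of_odd hp hodd fun q hq hqm => hpn q hq (hqm.mul_left _)
  have h2 := mul_sq_le_totientDivisorSum_two_pow hab k
  have h3 : totientDivisorSum (2 ^ k) (totientWeight a b) * totientDivisorSum m (fun d => (d : ℤ))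
      ≤ totientDivisorSum (2 ^ k * m) (totientWeight a b) := by
    rw [totientDivisorSum_mul hcop, ← totientDivisorSum_mul_right]
    refine totientDivisorSum_mono fun d hd => ?_
    rw [← totientDivisorSum_mul_left]
    refine totientDivisorSum_mono fun e he => ?_
    have hde : d.Coprime e := (hcop.coprime_dvd_left hd).coprime_dvd_right he
    -- This is `φ(d e) ≤ φ(d) e`: the totient is kept only on the 2-part.
    unfold totientWeight
    rw [Nat.totient_mul hde]
    have h4 : (Nat.totient e : ℤ) ≤ e := by exact_mod_cast Nat.totient_le e
    have h5 : 0 ≤ b * (Nat.totient d : ℤ) := by positivity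
    push_cast
    nlinarith
  have h0 := totientDivisorSum_cast_nonneg m
  have ha : 0 ≤ a := by linarith
  have hp0 : (0 : ℤ) ≤ p + 1 := by positivity
  have h6 := mul_le_mul_of_nonneg_right h2 h0
  have h7 := mul_le_mul_of_nonneg_left
    (h6.trans (by linarith : _ ≤ 2 * totientDivisorSum (2 ^ k * m) (totientWeight a b))) hp0
  have h8 := mul_le_mul_of_nonneg_left h1 (by positivity : 0 ≤ a * ((2 : ℤ) ^ k) ^ 2)
  push_cast
  linarith

/-! ### An element of large order -/

theorem sum_orderOf_eq_totientDivisorSum {G : Type*} [Group G] [Fintype G] [IsCyclic G]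
    (F : ℕ → ℤ) : ∑ g : G, F (orderOf g) = totientDivisorSum (Nat.card G) F := by
  classical
  unfold totientDivisorSum
  rw [← Finset.sum_fiberwise_of_maps_to (g := fun g : G => orderOf g)
    (t := (Nat.card G).divisors)
    fun g _ => Nat.mem_divisors.2 ⟨orderOf_dvd_natCard g, Nat.card_pos.ne'⟩]
  refine Finset.sum_congr rfl fun d hd => ?_
  rw [Finset.sum_congr rfl (g := fun _ => F d) fun g hg => by rw [(Finset.mem_filter.1 hg).2],
    Finset.sum_const, IsCyclic.card_orderOf_eq_totient, nsmul_eq_mul]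
  rw [← Nat.card_eq_fintype_card]
  exact Nat.dvd_of_mem_divisors hd

theorem exists_lt_mul_orderOf {G : Type*} [Group G] [Fintype G] {a b : ℤ} (hb : 0 < b)
    (hab : 2 * b ≤ a) {p : ℕ} (hp : 2 ≤ p) (hpn : ∀ q, q.Prime → q ∣ Nat.card G → q ≤ p)
    (h : totientDivisorSum (Nat.card G) (totientWeight a b)
      ≤ ∑ g : G, totientWeight a b (orderOf g)) :
    ∃ x : G, Nat.card G < p * orderOf x := by
  by_contra! hx
  have h1 := mul_sq_le_totientDivisorSum_totientWeight hb hab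
    (Nat.card_pos (α := G)).ne' hp hpn
  have ha : 0 < a := by linarith
  have hp0 : (2 : ℤ) ≤ p := by exact_mod_cast hp
  have h2 : ∑ g : G, p * totientWeight a b (orderOf g) < ∑ g : G, a * Nat.card G := by
    refine Finset.sum_lt_sum_of_nonempty Finset.univ_nonempty fun g _ => ?_
    have h3 := totientWeight_lt_mul (a := a) hb (orderOf_pos g)
    have h4 : (p : ℤ) * orderOf g ≤ Nat.card G := by exact_mod_cast hx g
    have h5 := mul_lt_mul_of_pos_left h3 (by linarith : (0 : ℤ) < p)
    have h6 := mul_le_mul_of_nonneg_left h4 ha.le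
    linarith
  rw [← Finset.mul_sum, Finset.sum_const, Finset.card_univ, ← Nat.card_eq_fintype_card,
    nsmul_eq_mul] at h2
  have h3 := mul_le_mul_of_nonneg_left h (by linarith : (0 : ℤ) ≤ p)
  have h4 := lt_of_le_of_lt h3 h2
  have h5 := mul_lt_mul_of_pos_left h4 (by linarith : (0 : ℤ) < 2 * (p + 1))
  have h6 := mul_le_mul_of_nonneg_left h1 (by linarith : (0 : ℤ) ≤ p)
  have h7 : 0 ≤ a * (Nat.card G : ℤ) ^ 2 := by positivity
  have h8 := mul_le_mul_of_nonneg_right hp0 h7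
  -- The bounds clash because `3 p ≥ 2 (p + 1)`, tight at `p = 2`; strictness comes from `φ > 0`.
  linarith

/-! ### Coprime action on a cyclic normal Sylow subgroup -/

theorem conj_pow_eq_zpow {G : Type*} [Group G] {y z : G} {l : ℤ} (h : y * z * y⁻¹ = z ^ l)
    (k : ℕ) : y ^ k * z * (y ^ k)⁻¹ = z ^ (l ^ k) := by
  induction k with
  | zero => simp
  | succ k ih =>
    calc y ^ (k + 1) * z * (y ^ (k + 1))⁻¹ = y ^ k * (y * z * y⁻¹) * (y ^ k)⁻¹ := by
          rw [pow_succ]; group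
      _ = (y ^ k * z * (y ^ k)⁻¹) ^ l := by rw [h, conj_zpow]
      _ = z ^ (l ^ (k + 1)) := by rw [ih, ← zpow_mul, pow_succ]

/-- If `w = (x y) ^ orderOf y` is nontrivial, it lies in the abelian group `⟨z⟩` and commutes with
`x y`, hence with `y`. Since `y` acts by `z ↦ z ^ l` and fixes `w`, `l ≡ 1` mod `p`; so `y ^ p ^ k`
centralizes `z`, and by coprimality so does `y`. -/
theorem mul_pow_orderOf_eq_one_or_commute {G : Type*} [Group G] [Finite G] {p k : ℕ}
    (hp : p.Prime) {y z : G} (hz : orderOf z = p ^ k) (hN : (Subgroup.zpowers z).Normal)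
    (hy : (orderOf y).Coprime p) :
    Commute y z ∨ ∀ x ∈ Subgroup.zpowers z, (x * y) ^ orderOf y = 1 := by
  by_contra! ⟨hnc, x, hx, hw⟩
  have hwP : (x * y) ^ orderOf y ∈ Subgroup.zpowers z := by
    rw [← QuotientGroup.eq_one_iff, QuotientGroup.mk_pow, QuotientGroup.mk_mul,
      (QuotientGroup.eq_one_iff x).2 hx, one_mul, ← QuotientGroup.mk_pow, pow_orderOf_eq_one,
      QuotientGroup.mk_one]
  have hwxy : Commute ((x * y) ^ orderOf y) (x * y) := (Commute.refl _).pow_left _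
  generalize (x * y) ^ orderOf y = w at hw hwP hwxy
  obtain ⟨i, rfl⟩ := Subgroup.mem_zpowers_iff.1 hx
  obtain ⟨j, rfl⟩ := Subgroup.mem_zpowers_iff.1 hwP
  have hwy : Commute (z ^ j) y := by
    have h1 : Commute (z ^ j) (z ^ i)⁻¹ :=
      (((Commute.refl z).zpow_left j).zpow_right i).inv_right
    simpa using h1.mul_right hwxy
  obtain ⟨l, hl⟩ := Subgroup.mem_zpowers_iff.1 (hN.conj_mem z (Subgroup.mem_zpowers z) y)
  have h1 : z ^ (l * j) = z ^ j := by
    rw [zpow_mul, hl, conj_zpow, ← hwy.eq, mul_inv_cancel_right]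
  have h2 : ((p : ℤ) ^ k) ∣ (l - 1) * j := by
    have h3 : z ^ ((l - 1) * j) = 1 := by rw [sub_mul, one_mul, zpow_sub, h1, mul_inv_cancel]
    have h4 := orderOf_dvd_iff_zpow_eq_one.2 h3
    rw [hz] at h4
    exact_mod_cast h4
  have h3 : (p : ℤ) ∣ l - 1 := by
    by_contra h4
    have h5 : IsCoprime ((p : ℤ) ^ k) (l - 1) :=
      ((Nat.prime_iff_prime_int.1 hp).coprime_iff_not_dvd.2 h4).pow_left
    have h6 := h5.dvd_of_dvd_mul_left h2
    refine hw (orderOf_dvd_iff_zpow_eq_one.1 ?_)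
    rw [hz]
    exact_mod_cast h6
  have h4 := dvd_sub_pow_of_dvd_sub h3 k
  rw [one_pow] at h4
  have h5 : y ^ p ^ k * z * (y ^ p ^ k)⁻¹ = z := by
    rw [conj_pow_eq_zpow hl.symm]
    have h6 : z ^ (l ^ p ^ k - 1) = 1 := by
      refine orderOf_dvd_iff_zpow_eq_one.1 ?_
      rw [hz]
      push_cast
      exact (pow_dvd_pow _ k.le_succ).trans h4
    rw [zpow_sub, zpow_one, mul_inv_eq_one] at h6
    exact h6
  have h6 : Commute (y ^ p ^ k) z := mul_inv_eq_iff_eq_mul.1 h5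
  obtain ⟨m, hm⟩ := exists_pow_eq_self_of_coprime (n := p ^ k) (x := y) (hy.symm.pow_left k)
  rw [← hm] at hnc
  exact hnc (h6.pow_left m)

theorem exists_normal_zpowers_of_lt_mul_orderOf {G : Type*} [Group G] [Finite G] {p : ℕ}
    (hp : p.Prime) {x : G} (hx : Nat.card G < p * orderOf x) :
    ∃ z : G, orderOf z = p ^ (Nat.card G).factorization p ∧ (Subgroup.zpowers z).Normal := by
  have : Fact p.Prime := ⟨hp⟩
  set n := Nat.card G with hn
  have hn0 : n ≠ 0 := Nat.card_pos.ne'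
  have hidx : orderOf x * (Subgroup.zpowers x).index = n := by
    rw [← Nat.card_zpowers, Subgroup.card_mul_index]
  have hlt : (Subgroup.zpowers x).index < p := by
    rw [← hidx, mul_comm p] at hx
    exact lt_of_mul_lt_mul_left hx (Nat.zero_le _)
  have hpos : 0 < (Subgroup.zpowers x).index := by
    rw [Nat.pos_iff_ne_zero]; intro h; rw [h] at hidx; omega
  have hdvd : p ^ n.factorization p ∣ orderOf x := by
    have h1 : p ^ n.factorization p ∣ orderOf x * (Subgroup.zpowers x).index :=
      hidx ▸ Nat.ordProj_dvd n p
    exact Nat.Coprime.dvd_of_dvd_mul_right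
      (Nat.Coprime.pow_left _ (Nat.coprime_of_lt_prime hpos.ne' hlt hp)) h1
  have hz : orderOf (x ^ (orderOf x / p ^ n.factorization p)) = p ^ n.factorization p :=
    orderOf_pow_orderOf_div (orderOf_pos x).ne' hdvd
  refine ⟨_, hz, ?_⟩
  set z := x ^ (orderOf x / p ^ n.factorization p)
  let P : Sylow p G := Sylow.ofCard (Subgroup.zpowers z) (by rw [Nat.card_zpowers, hz])
  have hle : Subgroup.zpowers x ≤ Subgroup.normalizer (P : Set G) := by
    rw [Subgroup.zpowers_le]
    have hc : Commute x z := (Commute.refl x).pow_right _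
    rw [Subgroup.mem_set_normalizer_iff]
    intro h
    have hcent : ∀ g ∈ Subgroup.zpowers z, x * g * x⁻¹ = g := by
      intro g hg
      obtain ⟨j, rfl⟩ := Subgroup.mem_zpowers_iff.1 hg
      rw [(hc.zpow_right j).eq, mul_inv_cancel_right]
    change h ∈ Subgroup.zpowers z ↔ x * h * x⁻¹ ∈ Subgroup.zpowers z
    constructor
    · intro hh; rwa [hcent h hh]
    · intro hh
      obtain ⟨j, hj⟩ := Subgroup.mem_zpowers_iff.1 hh
      have h1 : x * h * x⁻¹ = x * z ^ j * x⁻¹ := by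
        rw [hcent _ (Subgroup.zpow_mem_zpowers z j), hj]
      have h2 : h = z ^ j := by simpa using h1
      rw [h2]
      exact Subgroup.zpow_mem_zpowers z j
  -- The normalizer contains `⟨x⟩`, so there are fewer than `p` Sylow subgroups, and their number is
  -- `1` mod `p`.
  have hcard : Nat.card (Sylow p G) < p := by
    rw [P.card_eq_index_normalizer]
    exact lt_of_le_of_lt (Nat.le_of_dvd hpos (Subgroup.index_dvd_of_le hle)) hlt
  have hone : Nat.card (Sylow p G) = 1 := by
    have h1 := card_sylow_modEq_one p G
    unfold Nat.ModEq at h1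
    rwa [Nat.mod_eq_of_lt hcard, Nat.mod_eq_of_lt hp.one_lt] at h1
  have : Subsingleton (Sylow p G) := (Nat.card_eq_one_iff_unique.1 hone).1
  exact Sylow.normal_of_subsingleton P

/-! ### The induction through the complement -/

theorem isCyclic_of_totientDivisorSum_le_of_normal {G : Type*} [Group G] [Fintype G] {a b : ℤ}
    (hb : 0 < b) (hab : 2 * b ≤ a) {p : ℕ} (hp : p.Prime) (hpn : p ∣ Nat.card G) {z : G}
    (hz : orderOf z = p ^ (Nat.card G).factorization p) (hN : (Subgroup.zpowers z).Normal)
    (ih : ∀ (K : Subgroup G) (a b : ℤ), K ≠ ⊤ → 0 < b → 2 * b ≤ a → ∀ _ : Fintype K,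
      totientDivisorSum (Nat.card K) (totientWeight a b)
        ≤ ∑ g : K, totientWeight a b (orderOf g) → IsCyclic K)
    (h : totientDivisorSum (Nat.card G) (totientWeight a b)
      ≤ ∑ g : G, totientWeight a b (orderOf g)) : IsCyclic G := by
  classical
  set P := Subgroup.zpowers z with hP
  have hn0 : Nat.card G ≠ 0 := Nat.card_pos.ne'
  have hcardP : Nat.card P = p ^ (Nat.card G).factorization p := by rw [hP, Nat.card_zpowers, hz]
  have hfac : (Nat.card G).factorization p ≠ 0 := (hp.factorization_pos_of_dvd hn0 hpn).ne'
  have hz1 : 1 < orderOf z := by rw [hz]; exact Nat.one_lt_pow hfac hp.one_lt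
  have hidx : ¬ p ∣ P.index := by
    intro hd
    refine Nat.pow_succ_factorization_not_dvd hn0 hp ?_
    rw [pow_succ, ← hcardP, ← P.card_mul_index]
    exact mul_dvd_mul_left _ hd
  have hcop : (Nat.card P).Coprime P.index := by
    rw [hcardP]
    exact Nat.Coprime.pow_left _ ((Nat.Prime.coprime_iff_not_dvd hp).2 hidx)
  obtain ⟨K, hK⟩ := Subgroup.exists_right_complement'_of_coprime hcop
  have hcardK : Nat.card K = P.index := hK.symm.index_eq_card.symm
  have hPK : Nat.card P * Nat.card K = Nat.card G := by rw [hcardK, P.card_mul_index]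
  have hcopPK : (Nat.card P).Coprime (Nat.card K) := hcardK ▸ hcop
  have hKtop : K ≠ ⊤ := by
    rintro rfl
    rw [Subgroup.card_top, hcardP] at hcopPK
    have := Nat.Coprime.eq_one_of_dvd hcopPK (Nat.ordProj_dvd _ p)
    rw [← hz] at this
    omega
  have hord (x : P) (y : K) : (orderOf (x : G)).Coprime (orderOf (y : G)) := by
    rw [Subgroup.orderOf_coe, Subgroup.orderOf_coe]
    exact (hcopPK.coprime_dvd_left (orderOf_dvd_natCard x)).coprime_dvd_right
      (orderOf_dvd_natCard y)
  have hdich (y : K) : Commute (y : G) z ∨ ∀ x ∈ P, (x * (y : G)) ^ orderOf (y : G) = 1 := by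
    refine mul_pow_orderOf_eq_one_or_commute hp hz hN ?_
    have := (hord ⟨z, Subgroup.mem_zpowers z⟩ y).symm
    rw [hz] at this
    exact (Nat.coprime_pow_right_iff (Nat.pos_of_ne_zero hfac) _ _).1 this
  have hcomm {y : K} (hy : Commute (y : G) z) (x : P) :
      orderOf ((x : G) * y) = orderOf (x : G) * orderOf (y : G) := by
    obtain ⟨j, hj⟩ := Subgroup.mem_zpowers_iff.1 x.2
    refine Commute.orderOf_mul_eq_mul_orderOf_of_coprime ?_ (hord x y)
    rw [← hj]
    exact (hy.zpow_right j).symm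
  set W := totientWeight a b with hW
  have hterm (x : P) (y : K) :
      W (orderOf ((x : G) * y)) ≤ W (orderOf (x : G) * orderOf (y : G)) := by
    rcases hdich y with hy | hy
    · rw [hcomm hy]
    · exact totientWeight_le_of_dvd hb hab
        ((orderOf_dvd_of_pow_eq_one (hy x x.2)).trans (dvd_mul_left _ _))
        (Nat.mul_pos (orderOf_pos _) (orderOf_pos _))
  have hG : ∑ g : G, W (orderOf g) = ∑ x : P, ∑ y : K, W (orderOf ((x : G) * y)) := by
    rw [← Fintype.sum_prod_type']
    exact (Fintype.sum_bijective (fun q : P × K => (q.1 : G) * q.2) hK _ _ fun _ => rfl).symm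
  have hsub (x : P) : ∑ y : K, W (orderOf (x : G) * orderOf (y : G))
      = ∑ y : K, totientWeight (a * orderOf (x : G)) (b * (orderOf (x : G)).totient)
        (orderOf y) := by
    refine Finset.sum_congr rfl fun y _ => ?_
    rw [hW, totientWeight_mul _ _ (hord x y), Subgroup.orderOf_coe y]
  have hb' (x : P) : 0 < b * ((orderOf (x : G)).totient : ℤ) :=
    mul_pos hb (Int.natCast_pos.2 (Nat.totient_pos.2 (orderOf_pos (x : G))))
  have hab' (x : P) : 2 * (b * ((orderOf (x : G)).totient : ℤ)) ≤ a * orderOf (x : G) := by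
    have h1 : ((orderOf (x : G)).totient : ℤ) ≤ orderOf (x : G) :=
      Int.ofNat_le.2 (Nat.totient_le _)
    nlinarith
  have hdiv (x : P) : totientDivisorSum (Nat.card K) (fun e => W (orderOf (x : G) * e))
      = totientDivisorSum (Nat.card K)
        (totientWeight (a * orderOf (x : G)) (b * (orderOf (x : G)).totient)) := by
    refine Finset.sum_congr rfl fun e he => ?_
    refine congrArg _ (totientWeight_mul a b ?_)
    rw [Subgroup.orderOf_coe]
    exact (hcopPK.coprime_dvd_left (orderOf_dvd_natCard x)).coprime_dvd_right
      (Nat.dvd_of_mem_divisors he)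
  have hT : totientDivisorSum (Nat.card G) W
      = ∑ x : P, totientDivisorSum (Nat.card K) (fun e => W (orderOf (x : G) * e)) := by
    rw [← hPK, totientDivisorSum_mul hcopPK]
    simp only [Subgroup.orderOf_coe]
    exact (sum_orderOf_eq_totientDivisorSum (G := P) _).symm
  -- Otherwise induction, with the weight depending on `x`, makes every inner sum over `K` strictly
  -- too small.
  have hKcyc : IsCyclic K := by
    by_contra hnc
    refine absurd h (not_le.2 ?_)
    rw [hG, hT]
    refine Finset.sum_lt_sum_of_nonempty Finset.univ_nonempty fun x _ => ?_
    rw [hdiv]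
    refine lt_of_le_of_lt (Finset.sum_le_sum fun y _ => hterm x y) ?_
    rw [hsub]
    by_contra! hle
    exact hnc (ih K _ _ hKtop (hb' x) (hab' x) _ hle)
  -- If `y` does not centralize `z`, then `orderOf (z y)` is a proper divisor of `orderOf z *
  -- orderOf y`, and this one term gives strict inequality.
  have hall (y : K) : Commute (y : G) z := by
    by_contra hnc
    have hy := (hdich y).resolve_left hnc
    refine absurd h (not_le.2 ?_)
    have hTeq : totientDivisorSum (Nat.card G) W
        = ∑ x : P, ∑ y : K, W (orderOf (x : G) * orderOf (y : G)) := by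
      rw [hT]
      refine Finset.sum_congr rfl fun x _ => ?_
      simp only [Subgroup.orderOf_coe]
      exact (sum_orderOf_eq_totientDivisorSum (G := K) _).symm
    rw [hG, hTeq]
    refine Finset.sum_lt_sum (fun x _ => Finset.sum_le_sum fun y _ => hterm x y)
      ⟨⟨z, Subgroup.mem_zpowers z⟩, Finset.mem_univ _,
        Finset.sum_lt_sum (fun y _ => hterm _ y) ⟨y, Finset.mem_univ _, ?_⟩⟩
    have h1 := orderOf_dvd_of_pow_eq_one (hy z (Subgroup.mem_zpowers z))
    have h2 := orderOf_pos (y : G)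
    have h3 := Nat.le_of_dvd h2 h1
    have h4 : orderOf (y : G) < orderOf z * orderOf (y : G) := lt_mul_left h2 hz1
    exact totientWeight_lt_of_dvd hb hab (h1.trans (dvd_mul_left _ _)) (orderOf_pos _)
      (lt_of_le_of_lt h3 h4)
  obtain ⟨y, hy⟩ := IsCyclic.exists_generator (α := K)
  refine isCyclic_of_orderOf_eq_card (z * y) ?_
  have h1 := hcomm (hall y) ⟨z, Subgroup.mem_zpowers z⟩
  change orderOf (z * (y : G)) = orderOf z * orderOf (y : G) at h1
  rw [h1, ← hPK, hcardP, ← hz, Subgroup.orderOf_coe, orderOf_eq_card_of_forall_mem_zpowers hy]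

theorem isCyclic_of_totientDivisorSum_le {G : Type*} [Group G] [Fintype G] {a b : ℤ}
    (hb : 0 < b) (hab : 2 * b ≤ a)
    (h : totientDivisorSum (Nat.card G) (totientWeight a b)
      ≤ ∑ g : G, totientWeight a b (orderOf g)) : IsCyclic G := by
  induction hn : Nat.card G using Nat.strong_induction_on generalizing G a b with
  | _ n ih =>
    by_cases h1 : Nat.card G = 1
    · have : Subsingleton G := (Nat.card_eq_one_iff_unique.1 h1).1
      exact isCyclic_of_subsingleton
    have hne : (Nat.card G).primeFactors.Nonempty := by
      rw [Nat.nonempty_primeFactors]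
      have := Nat.card_pos (α := G)
      omega
    have hmem := Nat.mem_primeFactors.1 (Finset.max'_mem _ hne)
    have hmax (q : ℕ) (hq : q.Prime) (hqn : q ∣ Nat.card G) :
        q ≤ (Nat.card G).primeFactors.max' hne :=
      Finset.le_max' _ _ (Nat.mem_primeFactors.2 ⟨hq, hqn, Nat.card_pos.ne'⟩)
    generalize (Nat.card G).primeFactors.max' hne = p at hmem hmax
    obtain ⟨x, hx⟩ := exists_lt_mul_orderOf hb hab hmem.1.two_le hmax h
    obtain ⟨z, hz, hN⟩ := exists_normal_zpowers_of_lt_mul_orderOf hmem.1 hx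
    refine isCyclic_of_totientDivisorSum_le_of_normal hb hab hmem.1 hmem.2.1 hz hN ?_ h
    intro K a b hK hb hab _ hle
    refine ih (Nat.card K) ?_ hb hab hle rfl
    rw [← hn]
    exact lt_of_le_of_ne (Subgroup.card_le_card_group K) fun h => hK (Subgroup.eq_top_of_card_eq K h)

theorem mainTheorem3 {G : Type*} [Group G] [Fintype G] (n : ℕ) (hn : Nat.card G = n) :
    (∑ d ∈ n.divisors, (2 * (d : ℤ) - (Nat.totient d : ℤ)) * (Nat.totient d : ℤ)
        ≥ ∑ g : G, (2 * (orderOf g : ℤ) - (Nat.totient (orderOf g) : ℤ))) ∧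
    (∑ d ∈ n.divisors, (2 * (d : ℤ) - (Nat.totient d : ℤ)) * (Nat.totient d : ℤ)
        = ∑ g : G, (2 * (orderOf g : ℤ) - (Nat.totient (orderOf g) : ℤ))
      ↔ IsCyclic G) := by
  subst hn
  have hl : ∑ d ∈ (Nat.card G).divisors,
      (2 * (d : ℤ) - (Nat.totient d : ℤ)) * (Nat.totient d : ℤ)
      = totientDivisorSum (Nat.card G) (totientWeight 2 1) :=
    Finset.sum_congr rfl fun d _ => by rw [totientWeight, one_mul, mul_comm]
  have hr : ∑ g : G, (2 * (orderOf g : ℤ) - (Nat.totient (orderOf g) : ℤ))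
      = ∑ g : G, totientWeight 2 1 (orderOf g) :=
    Finset.sum_congr rfl fun g _ => by rw [totientWeight, one_mul]
  rw [hl, hr]
  have hcyc : IsCyclic G → totientDivisorSum (Nat.card G) (totientWeight 2 1)
      = ∑ g : G, totientWeight 2 1 (orderOf g) :=
    fun _ => (sum_orderOf_eq_totientDivisorSum _).symm
  have hle (h : totientDivisorSum (Nat.card G) (totientWeight 2 1)
      ≤ ∑ g : G, totientWeight 2 1 (orderOf g)) : IsCyclic G :=
    isCyclic_of_totientDivisorSum_le one_pos (by norm_num) h
  refine ⟨?_, fun h => hle h.le, hcyc⟩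
  by_contra! hlt
  exact hlt.ne (hcyc (hle hlt.le))
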